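/- Let $X$ be a first countable Hausdorff topological space, let $A$ be a complex Banach space, and give its dual $A^\vee$ (the continuous linear functionals) the dual norm. For a normed space $B$ and a map $\lambda$ from $X$ to the set $\operatorname{Sub}B$ of linear subspaces of $B$, the triple $(X,B,\lambda)$ is called a quotient vector bundle if $\lambda$ is continuous for the lower Vietoris topology on $\operatorname{Sub}B$, that is, the topology generated by the sets $\{V: V\cap U\neq\emptyset\}$ with $U\subset B$ open. Its associated bundle is $E=\coprod_{x\in X}B/\lambda(x)$, with the quotient topology from $q\colon B\times X\to E$, $q(b,x)=b+\lambda(x)\in B/\lambda(x)$, and the norm $\|q(b,x)\|=\operatorname{dist}(b,\lambda(x))$. We say that $(X,B,\lambda)$ is a Banach bundle if $E\to X$ is a Banach bundle: $E$ is Hausdorff, the projection $\pi\colon E\to X$ is continuous and open, the fibers are Banach spaces, the sum $E\times_XE\to E$, the scalar multiplication $\mathbb C\times E\to E$, the zero section $X\to E$ and the norm $E\to\mathbb R$ are continuous, and every net $(e_i)$ in $E$ with $\|e_i\|\to0$ and $\pi(e_i)\to x$ converges to $0\in E_x$. Let $\mathcal A=(X,A,\kappa)$ be a quotient vector bundle such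 that $\kappa(x)$ is closed in $A$ for every $x\in X$, and let $\mathcal A^\vee=(X,A^\vee,\kappa^\vee)$, where $\kappa^\vee(x)=\{\phi\in A^\vee:\phi|_{\kappa(x)}=0\}$. 1. If $\mathcal A^\vee$ is a quotient vector bundle, then both $\mathcal A$ and $\mathcal A^\vee$ are Banach bundles. 2. If $A$ is reflexive and Fréchet smooth (for every $a\in A$ with $\|a\|=1$ the limit $\lim_{\delta\to0}\frac{\|a-\delta b\|-\|a\|}{\delta}$, with $\delta$ real, exists uniformly in $b\in A$ with $\|b\|=1$), then $\mathcal A$ is a Banach bundle if and only if $\mathcal A^\vee$ is a Banach bundle. -/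

import Mathlib

open Topology

namespace QVB

/-! ### Linear bundles and Banach bundles -/

/-- The disjoint union `∐ x, E x` of a family of fibres. No topology is put on it by default. -/
structure Total {X : Type*} (E : X → Type*) where
  /-- The projection onto the base. -/
  proj : X
  /-- The vector in the fibre. -/
  vec : E proj

/-- The fibre product `E ×_X E`, as the type of triples `(x, u, v)` with `u v : E x`. -/
structure FibreSquare {X : Type*} (E : X → Type*) where
  /-- The base point. -/
  proj : X
  /-- The first vector. -/
  fst : E proj
  /-- The second vector. -/
  snd : E proj

/-- The fibre product carries the subspace topology of the product `E × E`. -/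
instance FibreSquare.instTopologicalSpace {X : Type*} (E : X → Type*)
    [TopologicalSpace (Total E)] : TopologicalSpace (FibreSquare E) :=
  TopologicalSpace.induced
    (fun p => ((⟨p.proj, p.fst⟩ : Total E), (⟨p.proj, p.snd⟩ : Total E))) inferInstance

/-- A family of complex vector spaces with a topology on the total space is a linear bundle if the
projection, the sum, the scalar multiplication and the zero section are continuous. -/
structure IsLinearBundle {X : Type*} [TopologicalSpace X] (E : X → Type*)
    [∀ x, AddCommGroup (E x)] [∀ x, Module ℂ (E x)] [TopologicalSpace (Total E)] : Prop where
  continuous_proj : Continuous (fun e : Total E => e.proj)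
  continuous_add : Continuous (fun p : FibreSquare E => (⟨p.proj, p.fst + p.snd⟩ : Total E))
  continuous_smul : Continuous (fun p : ℂ × Total E => (⟨p.2.proj, p.1 • p.2.vec⟩ : Total E))
  continuous_zero : Continuous (fun x : X => (⟨x, 0⟩ : Total E))

/-- Banach bundles in the sense of Fell and Doran: a linear bundle with Hausdorff total space and
open projection, whose fibres are Banach spaces (complete, with definite norm), such that the norm
is continuous on the total space, and `e → 0_x` whenever `‖e‖ → 0` and `proj e → x`. -/
structure IsBanachBundle {X : Type*} [TopologicalSpace X] (E : X → Type*)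
    [∀ x, SeminormedAddCommGroup (E x)] [∀ x, NormedSpace ℂ (E x)]
    [TopologicalSpace (Total E)] : Prop where
  isLinearBundle : IsLinearBundle E
  t2Space : T2Space (Total E)
  isOpenMap_proj : IsOpenMap (fun e : Total E => e.proj)
  eq_zero_of_norm_eq_zero : ∀ (x : X) (v : E x), ‖v‖ = 0 → v = 0
  completeSpace : ∀ x, CompleteSpace (E x)
  continuous_norm : Continuous (fun e : Total E => ‖e.vec‖)
  tendsto_zero : ∀ x : X,
    Filter.comap (fun e : Total E => ‖e.vec‖) (𝓝 0) ⊓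
      Filter.comap (fun e : Total E => e.proj) (𝓝 x) ≤ 𝓝 (⟨x, 0⟩ : Total E)

/-! ### Quotient vector bundles -/

/-- The lower Vietoris topology on the set of linear subspaces of `A`, generated by the sets
`{V | V ∩ U ≠ ∅}` with `U` open in `A`. -/
@[reducible]
def lowerVietoris (A : Type*) [NormedAddCommGroup A] [NormedSpace ℂ A] :
    TopologicalSpace (Submodule ℂ A) :=
  TopologicalSpace.generateFrom
    {s | ∃ U : Set A, IsOpen U ∧ s = {V : Submodule ℂ A | ((V : Set A) ∩ U).Nonempty}}

/-- The triple `(X, A, κ)` is a quotient vector bundle: the kernel map `κ` is continuous for the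
lower Vietoris topology. -/
def IsQuotientVectorBundle {X A : Type*} [TopologicalSpace X] [NormedAddCommGroup A]
    [NormedSpace ℂ A] (κ : X → Submodule ℂ A) : Prop :=
  Continuous[inferInstance, lowerVietoris A] κ

/-- The quotient map `q : A × X → E = ∐ x, A ⧸ κ x`. -/
def quotientMap {X A : Type*} [NormedAddCommGroup A] [NormedSpace ℂ A]
    (κ : X → Submodule ℂ A) (p : A × X) : Total (fun x => A ⧸ κ x) :=
  ⟨p.2, Submodule.Quotient.mk p.1⟩

/-- The quotient topology on `E = ∐ x, A ⧸ κ x`, coinduced by `q : A × X → E`. -/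
@[reducible]
def quotientTopology {X A : Type*} [TopologicalSpace X] [NormedAddCommGroup A] [NormedSpace ℂ A]
    (κ : X → Submodule ℂ A) : TopologicalSpace (Total (fun x => A ⧸ κ x)) :=
  TopologicalSpace.coinduced (quotientMap κ) inferInstance

/-- The bundle `E = ∐ x, A ⧸ κ x` associated with `(X, A, κ)`, with the quotient topology and the
quotient norm `‖q (a, x)‖ = dist (a, κ x)`, is a Banach bundle. -/
def AssociatedIsBanachBundle {X A : Type*} [TopologicalSpace X] [NormedAddCommGroup A]
    [NormedSpace ℂ A] (κ : X → Submodule ℂ A) : Prop :=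
  letI := quotientTopology κ
  IsBanachBundle (fun x => A ⧸ κ x)

/-! ### The codual bundle -/

/-- The annihilator of a subspace `V` of `A` in the normed dual of `A`. -/
def annihilator {A : Type*} [NormedAddCommGroup A] [NormedSpace ℂ A] (V : Submodule ℂ A) :
    Submodule ℂ (StrongDual ℂ A) where
  carrier := {φ | ∀ a ∈ V, φ a = 0}
  add_mem' := by
    intro φ ψ hφ hψ a ha
    simp [hφ a ha, hψ a ha]
  zero_mem' := by
    intro a _
    simp
  smul_mem' := by
    intro c φ hφ a ha
    simp [hφ a ha]

/-- The kernel map of the codual bundle: `x` is sent to the annihilator of `κ x`. -/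
def codual {X A : Type*} [NormedAddCommGroup A] [NormedSpace ℂ A] (κ : X → Submodule ℂ A) :
    X → Submodule ℂ (StrongDual ℂ A) :=
  fun x => annihilator (κ x)

/-! ### Geometry of normed spaces -/

/-- `A` is reflexive: the canonical map into the double dual is surjective. -/
def IsReflexive (A : Type*) [NormedAddCommGroup A] [NormedSpace ℂ A] : Prop :=
  Function.Surjective (NormedSpace.inclusionInDoubleDual ℂ A)

/-- `A` is Fréchet smooth: at each unit vector `a`, the limit of `(‖a - δ b‖ - ‖a‖) / δ` as the
real number `δ ≠ 0` tends to `0` exists uniformly in the unit vector `b`. -/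
def IsFrechetSmooth (A : Type*) [NormedAddCommGroup A] [NormedSpace ℂ A] : Prop :=
  ∀ a ∈ Metric.sphere (0 : A) 1, ∃ g : A → ℝ,
    TendstoUniformlyOn (fun (δ : ℝ) (b : A) => (‖a - (δ : ℂ) • b‖ - ‖a‖) / δ) g (𝓝[≠] 0)
      (Metric.sphere (0 : A) 1)

end QVB

namespace QVB

open Filter

/-! ### Quotient bundles with lower semicontinuous norm are Banach bundles -/

section Bundle

variable {X B : Type*} [NormedAddCommGroup B] [NormedSpace ℂ B] {κ : X → Submodule ℂ B}

/-! For a quotient vector bundle with closed kernels, `dist (b, κ x)` is upper semicontinuous in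
`x`, since good approximants in `κ x` persist nearby. Only lower semicontinuity is missing for a
Banach bundle, and Hahn–Banach duality supplies it: `dist (a, κ x)` is the maximum of `‖φ a‖` over
the unit ball of the annihilator, and `dist (φ, codual κ x)` is the norm of `φ` on `κ x`. Hence
continuity of either kernel map makes the norm of the other bundle lower semicontinuous, which is
the first claim. The second claim reduces to the first. A continuous bundle norm makes its kernel
map continuous. For the passage from `κ` to `codual κ`, reflexivity makes a unit `φ` in the
annihilator attain its norm at some `a`; functionals annihilating `κ y` and almost norming `a` exist
for `y` near `x`, and by Šmulian's lemma they are close to `φ`. -/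

theorem le_norm_quotient_mk {V : Submodule ℂ B} {b : B} {r : ℝ}
    (h : ∀ k ∈ V, r ≤ ‖b + k‖) : r ≤ ‖(Submodule.Quotient.mk b : B ⧸ V)‖ := by
  refine le_of_forall_pos_lt_add fun ε hε => ?_
  obtain ⟨m, hm, hlt⟩ := Submodule.Quotient.norm_mk_lt (Submodule.Quotient.mk b : B ⧸ V) hε
  have hmem : m - b ∈ V := (Submodule.Quotient.eq V).1 hm
  have := h _ hmem
  rw [add_sub_cancel] at this
  exact this.trans_lt hlt

theorem exists_norm_add_lt {V : Submodule ℂ B} {b : B} {r : ℝ}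
    (h : ‖(Submodule.Quotient.mk b : B ⧸ V)‖ < r) : ∃ k ∈ V, ‖b + k‖ < r := by
  by_contra! hcon
  exact (le_norm_quotient_mk hcon).not_gt h

theorem norm_quotient_mk_le_norm_add {V : Submodule ℂ B} (b : B) {k : B} (hk : k ∈ V) :
    ‖(Submodule.Quotient.mk b : B ⧸ V)‖ ≤ ‖b + k‖ := by
  have : (Submodule.Quotient.mk b : B ⧸ V) = Submodule.Quotient.mk (b + k) := by
    rw [Submodule.Quotient.eq]
    simpa using hk
  rw [this]
  exact Submodule.Quotient.norm_mk_le _ _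

theorem norm_quotient_mk_le_add (V : Submodule ℂ B) (b c : B) :
    ‖(Submodule.Quotient.mk b : B ⧸ V)‖ ≤
      ‖(Submodule.Quotient.mk c : B ⧸ V)‖ + ‖b - c‖ := by
  have h : (Submodule.Quotient.mk b : B ⧸ V) =
      Submodule.Quotient.mk c + Submodule.Quotient.mk (b - c) := by
    rw [← Submodule.Quotient.mk_add, add_sub_cancel]
  rw [h]
  exact (norm_add_le _ _).trans (by gcongr; exact Submodule.Quotient.norm_mk_le _ _)

theorem norm_quotient_mk_eq_zero_iff {V : Submodule ℂ B} (hV : IsClosed (V : Set B)) (b : B) :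
    ‖(Submodule.Quotient.mk b : B ⧸ V)‖ = 0 ↔ b ∈ V := by
  have : IsClosed (V : Set B) := hV
  rw [norm_eq_zero, Submodule.Quotient.mk_eq_zero]

theorem quotientMap_surjective : Function.Surjective (quotientMap κ) := by
  rintro ⟨x, v⟩
  obtain ⟨b, rfl⟩ := Submodule.Quotient.mk_surjective _ v
  exact ⟨(b, x), rfl⟩

theorem quotientMap_eq_iff {b c : B} {x y : X} :
    quotientMap κ (b, x) = quotientMap κ (c, y) ↔ x = y ∧ b - c ∈ κ x := by
  constructor
  · intro h
    obtain rfl : x = y := congrArg Total.proj h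
    simp only [quotientMap, Total.mk.injEq, heq_eq_eq, true_and] at h
    exact ⟨rfl, (Submodule.Quotient.eq _).1 h⟩
  · rintro ⟨rfl, h⟩
    simp only [quotientMap, Total.mk.injEq, heq_eq_eq, true_and]
    exact (Submodule.Quotient.eq _).2 h

variable [TopologicalSpace X]

theorem isQuotientVectorBundle_iff :
    IsQuotientVectorBundle κ ↔
      ∀ U : Set B, IsOpen U → IsOpen {x | ((κ x : Set B) ∩ U).Nonempty} := by
  unfold IsQuotientVectorBundle
  rw [continuous_generateFrom_iff]
  constructor
  · intro h U hU
    exact h _ ⟨U, hU, rfl⟩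
  · rintro h _ ⟨U, hU, rfl⟩
    exact h U hU

theorem IsQuotientVectorBundle.eventually_exists_mem (hκ : IsQuotientVectorBundle κ) {U : Set B}
    (hU : IsOpen U) {x : X} {k : B} (hk : k ∈ κ x) (hkU : k ∈ U) :
    ∀ᶠ y in 𝓝 x, ∃ l ∈ κ y, l ∈ U :=
  (isQuotientVectorBundle_iff.1 hκ U hU).mem_nhds ⟨k, hk, hkU⟩

/-- If `(b + k, x)` lies in an open `U` with `k ∈ κ x`, nearby fibres contain vectors `l` close to
`k`, so `(b' + l, y)` stays in `U`: saturations of open sets are open. -/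
theorem IsQuotientVectorBundle.isOpenQuotientMap (hκ : IsQuotientVectorBundle κ) :
    letI := quotientTopology κ
    IsOpenQuotientMap (quotientMap κ) := by
  let := quotientTopology κ
  refine ⟨quotientMap_surjective, continuous_coinduced_rng, fun U hU => ?_⟩
  rw [isOpen_coinduced, isOpen_iff_mem_nhds]
  rintro ⟨b, x⟩ ⟨⟨c, y⟩, hcU, hc⟩
  obtain ⟨rfl, hk⟩ := quotientMap_eq_iff.1 hc
  have hcont : Continuous fun p : (B × B) × X => (p.1.1 + p.1.2, p.2) := by fun_prop
  have hmem : {p : (B × B) × X | (p.1.1 + p.1.2, p.2) ∈ U} ∈ 𝓝 ((b, c - b), y) :=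
    (hU.preimage hcont).mem_nhds (by simpa using hcU)
  rw [nhds_prod_eq, nhds_prod_eq, mem_prod_iff] at hmem
  obtain ⟨s, hs, W, hW, hsub⟩ := hmem
  obtain ⟨s₁, hs₁, s₂, hs₂, hs₁₂⟩ := mem_prod_iff.1 hs
  obtain ⟨O, hOs, hO, hmO⟩ := mem_nhds_iff.1 hs₂
  have hev := hκ.eventually_exists_mem hO hk hmO
  rw [nhds_prod_eq]
  filter_upwards [prod_mem_prod hs₁ (inter_mem hW hev)]
  rintro ⟨b', y'⟩ ⟨hb', hy', l, hl, hlO⟩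
  refine ⟨(b' + l, y'), hsub (show ((b', l), y') ∈ s ×ˢ W from ⟨hs₁₂ ⟨hb', hOs hlO⟩, hy'⟩), ?_⟩
  exact quotientMap_eq_iff.2 ⟨rfl, by simpa using hl⟩

/-- The quotient norm is automatically upper semicontinuous, so that lower semicontinuity along the
base yields joint continuity. -/
theorem IsQuotientVectorBundle.continuous_norm_mk (hκ : IsQuotientVectorBundle κ)
    (hlsc : ∀ b : B, LowerSemicontinuous fun x => ‖(Submodule.Quotient.mk b : B ⧸ κ x)‖) :
    Continuous fun p : B × X => ‖(Submodule.Quotient.mk p.1 : B ⧸ κ p.2)‖ := by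
  rw [continuous_iff_continuousAt]
  rintro ⟨b, x⟩
  rw [ContinuousAt, Metric.tendsto_nhds]
  intro ε hε
  have h₁ := hlsc b x (‖(Submodule.Quotient.mk b : B ⧸ κ x)‖ - ε / 2) (by linarith)
  obtain ⟨k, hk, hkε⟩ := exists_norm_add_lt
    (show ‖(Submodule.Quotient.mk b : B ⧸ κ x)‖ <
      ‖(Submodule.Quotient.mk b : B ⧸ κ x)‖ + ε / 2 by linarith)
  have hO : IsOpen {l : B | ‖b + l‖ < ‖(Submodule.Quotient.mk b : B ⧸ κ x)‖ + ε / 2} :=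
    isOpen_lt (by fun_prop) continuous_const
  have h₂ := hκ.eventually_exists_mem hO hk hkε
  rw [nhds_prod_eq]
  filter_upwards [prod_mem_prod (Metric.ball_mem_nhds b (half_pos hε)) (inter_mem h₁ h₂)]
  rintro ⟨c, y⟩ ⟨hc, hy, l, hl, hlO⟩
  have hcb : ‖c - b‖ < ε / 2 := by simpa [dist_eq_norm] using hc
  have hbc : ‖b - c‖ < ε / 2 := by rwa [norm_sub_rev]
  have h₃ := norm_quotient_mk_le_norm_add b hl
  have h₄ := norm_quotient_mk_le_add (κ y) b c
  have h₅ := norm_quotient_mk_le_add (κ y) c b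
  simp only [Set.mem_ofPred_eq] at hy hlO
  rw [Real.dist_eq, abs_lt]
  constructor <;> dsimp only <;> linarith

theorem IsQuotientVectorBundle.isLinearBundle (hκ : IsQuotientVectorBundle κ) :
    letI := quotientTopology κ
    IsLinearBundle (fun x => B ⧸ κ x) := by
  let := quotientTopology κ
  have hq : IsOpenQuotientMap (quotientMap κ) := hκ.isOpenQuotientMap
  refine ⟨?_, ?_, ?_, ?_⟩
  · exact hq.continuous_comp_iff.1 continuous_snd
  · rw [continuous_iff_continuousAt]
    rintro ⟨x, u, v⟩
    obtain ⟨b, rfl⟩ := Submodule.Quotient.mk_surjective _ u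
    obtain ⟨c, rfl⟩ := Submodule.Quotient.mk_surjective _ v
    intro V hV
    have hcont : Continuous fun p : (B × X) × (B × X) =>
        quotientMap κ (p.1.1 + p.2.1, p.1.2) := hq.continuous.comp (by fun_prop)
    have hS := hcont.continuousAt (x := ((b, x), (c, x))) hV
    have hS' := image_mem_map (m := Prod.map (quotientMap κ) (quotientMap κ)) hS
    rw [(hq.prodMap hq).map_nhds_eq] at hS'
    refine mem_map.2 ?_
    rw [nhds_induced]
    refine mem_of_superset (preimage_mem_comap hS') ?_
    rintro ⟨y, u, v⟩ ⟨⟨⟨b', y₁⟩, c', y₂⟩, hmem, heq⟩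
    simp only [Prod.map_apply, Prod.mk.injEq] at heq
    obtain ⟨h₁, h₂⟩ := heq
    cases h₁
    cases h₂
    exact hmem
  · refine (IsOpenQuotientMap.id.prodMap hq).continuous_comp_iff.1 ?_
    have hcont : Continuous fun p : ℂ × (B × X) => quotientMap κ (p.1 • p.2.1, p.2.2) :=
      hq.continuous.comp (by fun_prop)
    exact hcont
  · have hcont : Continuous fun x : X => quotientMap κ (0, x) :=
      hq.continuous.comp (by fun_prop)
    exact hcont

theorem IsQuotientVectorBundle.associatedIsBanachBundle [T2Space X] [CompleteSpace B]
    (hκ : IsQuotientVectorBundle κ) (hclosed : ∀ x, IsClosed (κ x : Set B))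
    (hlsc : ∀ b : B, LowerSemicontinuous fun x => ‖(Submodule.Quotient.mk b : B ⧸ κ x)‖) :
    AssociatedIsBanachBundle κ := by
  let := quotientTopology κ
  have hq : IsOpenQuotientMap (quotientMap κ) := hκ.isOpenQuotientMap
  have hnorm := hκ.continuous_norm_mk hlsc
  refine ⟨hκ.isLinearBundle, ?_, ?_, ?_, fun x => inferInstance, ?_, ?_⟩
  -- Since `q` is open, it suffices that its kernel relation is closed; it is cut out by equal base
  -- points and vanishing norm of the difference.
  · rw [t2Space_iff_of_isOpenQuotientMap hq]
    have hset : {p : (B × X) × (B × X) | quotientMap κ p.1 = quotientMap κ p.2} =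
        {p | p.1.2 = p.2.2} ∩
          {p | ‖(Submodule.Quotient.mk (p.1.1 - p.2.1) : B ⧸ κ p.1.2)‖ = 0} := by
      ext ⟨⟨b, x⟩, c, y⟩
      simp only [Set.mem_ofPred_eq, Set.mem_inter_iff, quotientMap_eq_iff,
        norm_quotient_mk_eq_zero_iff (hclosed x)]
    rw [hset]
    refine (isClosed_eq (by fun_prop) (by fun_prop)).inter (isClosed_eq ?_ continuous_const)
    exact hnorm.comp (g := fun p : B × X => ‖(Submodule.Quotient.mk p.1 : B ⧸ κ p.2)‖)
      (f := fun p : (B × X) × (B × X) => (p.1.1 - p.2.1, p.1.2)) (by fun_prop)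
  · exact hq.isOpenMap_iff.2 isOpenMap_snd
  · intro x v hv
    obtain ⟨b, rfl⟩ := Submodule.Quotient.mk_surjective _ v
    rw [Submodule.Quotient.mk_eq_zero]
    exact (norm_quotient_mk_eq_zero_iff (hclosed x) b).1 hv
  · exact hq.continuous_comp_iff.1 hnorm
  · intro x V hV
    have hS : quotientMap κ ⁻¹' V ∈ 𝓝 ((0 : B), x) := hq.continuous.continuousAt hV
    rw [nhds_prod_eq, mem_prod_iff] at hS
    obtain ⟨s, hs, W, hW, hsub⟩ := hS
    obtain ⟨ε, hε, hball⟩ := Metric.mem_nhds_iff.1 hs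
    refine mem_of_superset (inter_mem_inf (preimage_mem_comap (Iio_mem_nhds hε))
      (preimage_mem_comap hW)) ?_
    rintro ⟨y, v⟩ ⟨hv, hy⟩
    obtain ⟨b, rfl⟩ := Submodule.Quotient.mk_surjective _ v
    obtain ⟨k, hk, hkε⟩ := exists_norm_add_lt (show ‖_‖ < ε from hv)
    have hmem : quotientMap κ (b + k, y) ∈ V :=
      hsub (show (b + k, y) ∈ s ×ˢ W from ⟨hball (by simpa using hkε), hy⟩)
    rwa [show quotientMap κ (b + k, y) = quotientMap κ (b, y) from
      quotientMap_eq_iff.2 ⟨rfl, by simpa using hk⟩] at hmem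

theorem AssociatedIsBanachBundle.continuous_norm_mk (h : AssociatedIsBanachBundle κ) (b : B) :
    Continuous fun x => ‖(Submodule.Quotient.mk b : B ⧸ κ x)‖ := by
  let := quotientTopology κ
  have hq : Continuous (quotientMap κ) := continuous_coinduced_rng
  have hcont : Continuous fun x : X => quotientMap κ (b, x) := hq.comp (by fun_prop)
  have h' : IsBanachBundle (fun x => B ⧸ κ x) := h
  have hnorm : Continuous fun e : Total (fun x => B ⧸ κ x) => ‖e.vec‖ := h'.continuous_norm
  exact (hnorm.comp hcont).congr fun x => rfl

/-- A vector of `κ x` has distance `0` to `κ x`, hence small distance to `κ y` for `y` near `x`. -/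
theorem AssociatedIsBanachBundle.isQuotientVectorBundle (h : AssociatedIsBanachBundle κ) :
    IsQuotientVectorBundle κ := by
  rw [isQuotientVectorBundle_iff]
  intro U hU
  rw [isOpen_iff_mem_nhds]
  rintro x ⟨k, hk, hkU⟩
  obtain ⟨ε, hε, hball⟩ := Metric.isOpen_iff.1 hU k hkU
  have hzero : ‖(Submodule.Quotient.mk k : B ⧸ κ x)‖ < ε := by
    rwa [(Submodule.Quotient.mk_eq_zero _).2 hk, norm_zero]
  filter_upwards [(h.continuous_norm_mk k).continuousAt.eventually_lt_const hzero] with y hy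
  obtain ⟨l, hl, hlε⟩ := exists_norm_add_lt hy
  refine ⟨-l, neg_mem hl, hball ?_⟩
  rwa [mem_ball_iff_norm', sub_neg_eq_add]

end Bundle

/-! ### Duality between quotient norms -/

section Dual

variable {X A : Type*} [TopologicalSpace X] [NormedAddCommGroup A] [NormedSpace ℂ A]
  {κ : X → Submodule ℂ A}

theorem mem_annihilator {V : Submodule ℂ A} {φ : StrongDual ℂ A} :
    φ ∈ annihilator V ↔ ∀ a ∈ V, φ a = 0 := Iff.rfl

theorem isClosed_annihilator (V : Submodule ℂ A) :
    IsClosed (annihilator V : Set (StrongDual ℂ A)) := by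
  have : (annihilator V : Set (StrongDual ℂ A)) = ⋂ a ∈ V, {φ | φ a = 0} := by
    ext φ
    simp [mem_annihilator]
  rw [this]
  exact isClosed_biInter fun a _ => isClosed_eq (by fun_prop) continuous_const

theorem norm_apply_le_of_mem_annihilator {V : Submodule ℂ A} {φ : StrongDual ℂ A}
    (hφ : φ ∈ annihilator V) (hφ' : ‖φ‖ ≤ 1) (a : A) :
    ‖φ a‖ ≤ ‖(Submodule.Quotient.mk a : A ⧸ V)‖ := by
  refine le_norm_quotient_mk fun k hk => ?_
  have : φ a = φ (a + k) := by rw [map_add, mem_annihilator.1 hφ k hk, add_zero]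
  rw [this]
  exact φ.le_of_opNorm_le hφ' _ |>.trans_eq (one_mul _)

theorem norm_apply_le_of_mem {V : Submodule ℂ A} {a : A} (ha : a ∈ V) (ha' : ‖a‖ ≤ 1)
    (φ : StrongDual ℂ A) :
    ‖φ a‖ ≤ ‖(Submodule.Quotient.mk φ : StrongDual ℂ A ⧸ annihilator V)‖ := by
  refine le_norm_quotient_mk fun ψ hψ => ?_
  have : φ a = (φ + ψ) a := by
    rw [add_apply, mem_annihilator.1 hψ a ha, add_zero]
  rw [this]
  exact (φ + ψ).unit_le_opNorm a ha'

/-- Pull back to `A` a norming functional of the class of `a` in `A ⧸ V`. -/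
theorem exists_mem_annihilator_apply_eq (V : Submodule ℂ A) (a : A) :
    ∃ φ ∈ annihilator V, ‖φ‖ ≤ 1 ∧ φ a = ‖(Submodule.Quotient.mk a : A ⧸ V)‖ := by
  obtain ⟨g, hg, hga⟩ := exists_dual_vector'' ℂ (Submodule.Quotient.mk a : A ⧸ V)
  have hle : ∀ b : A, ‖g (V.mkQ b)‖ ≤ 1 * ‖b‖ := fun b =>
    (g.le_of_opNorm_le hg _).trans (by gcongr; exact Submodule.Quotient.norm_mk_le _ _)
  refine ⟨(g.toLinearMap ∘ₗ V.mkQ).mkContinuous 1 hle, ?_,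
    LinearMap.mkContinuous_norm_le _ zero_le_one _, hga⟩
  intro b hb
  simp [(Submodule.Quotient.mk_eq_zero V).2 hb]

/-- A norm-preserving extension of `φ` restricted to `V` differs from `φ` by an annihilating
functional. -/
theorem norm_quotient_annihilator_le (V : Submodule ℂ A) (φ : StrongDual ℂ A) :
    ‖(Submodule.Quotient.mk φ : StrongDual ℂ A ⧸ annihilator V)‖ ≤ ‖φ.comp V.subtypeL‖ := by
  obtain ⟨ψ, hψ, hnorm⟩ := exists_extension_norm_eq V (φ.comp V.subtypeL)
  have h : ψ - φ ∈ annihilator V := fun a ha => by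
    have := hψ ⟨a, ha⟩
    simp only [ContinuousLinearMap.comp_apply, Submodule.subtypeL_apply] at this
    rw [sub_apply, this, sub_self]
  have := norm_quotient_mk_le_norm_add φ h
  rwa [add_sub_cancel, hnorm] at this

theorem IsQuotientVectorBundle.lowerSemicontinuous_norm_of_codual
    (hκ : IsQuotientVectorBundle (codual κ)) (a : A) :
    LowerSemicontinuous fun x => ‖(Submodule.Quotient.mk a : A ⧸ κ x)‖ := by
  intro x r hr
  obtain ⟨φ, hφ, hφ₁, hφa⟩ := exists_mem_annihilator_apply_eq (κ x) a
  have hlt : r < ‖φ a‖ := by rw [hφa]; simpa using hr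
  -- Scale `φ` slightly so that it lies in the open unit ball.
  have hcont : Continuous fun t : ℝ => ‖((t : ℂ) • φ) a‖ := by
    simp only [smul_apply, norm_smul, Complex.norm_real]; fun_prop
  have hev : ∀ᶠ t : ℝ in 𝓝[<] 1, r < ‖((t : ℂ) • φ) a‖ :=
    ((hcont.tendsto 1).eventually_const_lt (by simpa using hlt)).filter_mono nhdsWithin_le_nhds
  obtain ⟨t, htr, ht⟩ := (hev.and (Ioo_mem_nhdsLT (show (0 : ℝ) < 1 by norm_num))).exists
  have hO : IsOpen {ψ : StrongDual ℂ A | ‖ψ‖ < 1 ∧ r < ‖ψ a‖} :=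
    (isOpen_lt continuous_norm continuous_const).inter
      (isOpen_lt continuous_const (by fun_prop : Continuous fun ψ : StrongDual ℂ A => ‖ψ a‖))
  have hnorm : ‖(t : ℂ) • φ‖ < 1 := by
    rw [norm_smul, Complex.norm_real, Real.norm_eq_abs, abs_of_pos ht.1]
    nlinarith [ht.1, ht.2, norm_nonneg φ]
  filter_upwards [hκ.eventually_exists_mem hO (Submodule.smul_mem _ (t : ℂ) hφ) ⟨hnorm, htr⟩]
  rintro y ⟨ψ, hψ, hψ₁, hψr⟩
  exact hψr.trans_le (norm_apply_le_of_mem_annihilator hψ hψ₁.le a)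

theorem IsQuotientVectorBundle.lowerSemicontinuous_norm_codual
    (hκ : IsQuotientVectorBundle κ) (φ : StrongDual ℂ A) :
    LowerSemicontinuous fun x =>
      ‖(Submodule.Quotient.mk φ : StrongDual ℂ A ⧸ codual κ x)‖ := by
  intro x r hr
  obtain ⟨⟨a, ha⟩, ha₁, har⟩ := (φ.comp (κ x).subtypeL).exists_lt_apply_of_lt_opNorm
    (lt_of_lt_of_le hr (norm_quotient_annihilator_le (κ x) φ))
  -- Strict inequalities make this witness condition open, so it persists in nearby fibres.
  have hO : IsOpen {b : A | ‖b‖ < 1 ∧ r < ‖φ b‖} :=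
    (isOpen_lt continuous_norm continuous_const).inter
      (isOpen_lt continuous_const φ.continuous.norm)
  filter_upwards [hκ.eventually_exists_mem hO ha ⟨ha₁, har⟩]
  rintro y ⟨b, hb, hb₁, hbr⟩
  exact hbr.trans_le (norm_apply_le_of_mem hb hb₁.le φ)

end Dual

/-! ### Fréchet smoothness and continuity of the annihilator -/

section Smooth

variable {X A : Type*} [TopologicalSpace X] [NormedAddCommGroup A] [NormedSpace ℂ A]
  {κ : X → Submodule ℂ A}

/-- A norming element of the double dual is evaluation at a point. -/
theorem IsReflexive.exists_apply_eq_norm (hA : IsReflexive A) (φ : StrongDual ℂ A) :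
    ∃ a : A, ‖a‖ ≤ 1 ∧ φ a = ‖φ‖ := by
  obtain ⟨F, hF, hFφ⟩ := exists_dual_vector'' ℂ φ
  obtain ⟨a, rfl⟩ := hA F
  refine ⟨a, ?_, by simpa using hFφ⟩
  rwa [← (NormedSpace.inclusionInDoubleDualLi ℂ (E := A)).norm_map a]

theorem norm_le_of_re_le {φ : StrongDual ℂ A} {C : ℝ} (hC : 0 ≤ C)
    (h : ∀ b : A, ‖b‖ = 1 → (φ b).re ≤ C) : ‖φ‖ ≤ C := by
  refine φ.opNorm_le_of_unit_norm hC fun b hb => ?_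
  obtain ⟨c, hc, hcb⟩ := RCLike.exists_norm_eq_mul_self (φ b)
  have := h (c • b) (by rw [norm_smul, hc, hb, one_mul])
  rw [map_smul, smul_eq_mul, ← hcb] at this
  exact this

theorem re_apply_le {ψ : StrongDual ℂ A} (hψ : ‖ψ‖ ≤ 1) (a : A) : (ψ a).re ≤ ‖a‖ :=
  (Complex.re_le_norm _).trans ((ψ.le_of_opNorm_le hψ a).trans_eq (one_mul _))

/-- Šmulian's lemma: at a point of Fréchet smoothness of the norm, functionals of the unit ball
that almost norm the point are close to each other. -/
theorem IsFrechetSmooth.exists_norm_sub_le (hA : IsFrechetSmooth A) {a : A} (ha : ‖a‖ = 1)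
    {ε : ℝ} (hε : 0 < ε) :
    ∃ η > 0, ∀ φ ψ : StrongDual ℂ A, ‖φ‖ ≤ 1 → ‖ψ‖ ≤ 1 → 1 - η ≤ (φ a).re →
      1 - η ≤ (ψ a).re → ‖ψ - φ‖ ≤ ε := by
  obtain ⟨g, hg⟩ := hA a (by simpa using ha)
  rw [Metric.tendstoUniformlyOn_iff] at hg
  have hev := hg (ε / 4) (by positivity)
  rw [eventually_nhdsWithin_iff, Metric.eventually_nhds_iff] at hev
  obtain ⟨δ, hδ, hball⟩ := hev
  set s := δ / 2 with hs
  have hs0 : 0 < s := by positivity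
  -- Bounding `Re χ` by the norm at `a ∓ s b` pins `Re χ b` near `-g b`. After division by `s`, the
  -- defect at `a` and the error of the difference quotient cost `ε / 4` each.
  have key : ∀ χ : StrongDual ℂ A, ‖χ‖ ≤ 1 → 1 - s * (ε / 4) ≤ (χ a).re →
      ∀ b : A, ‖b‖ = 1 → |(χ b).re + g b| ≤ ε / 2 := by
    intro χ hχ hχa b hb
    have hp := hball (y := s) (by rw [Real.dist_eq, sub_zero, abs_of_pos hs0]; linarith) hs0.ne'
      b (by simpa using hb)
    have hn := hball (y := -s)
      (by rw [Real.dist_eq, sub_zero, abs_neg, abs_of_pos hs0]; linarith)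
      (neg_ne_zero.2 hs0.ne') b (by simpa using hb)
    have rp := re_apply_le hχ (a - (s : ℂ) • b)
    have rn := re_apply_le hχ (a - ((-s : ℝ) : ℂ) • b)
    simp only [map_sub, map_smul, smul_eq_mul, Complex.sub_re, Complex.re_ofReal_mul] at rp rn
    rw [Real.dist_eq, abs_lt, ha] at hp hn
    set P := ‖a - (s : ℂ) • b‖
    set N := ‖a - ((-s : ℝ) : ℂ) • b‖
    have hp' : (P - 1) / s < g b + ε / 4 := by linarith [hp.1]
    have hn' : g b - ε / 4 < (N - 1) / (-s) := by linarith [hn.2]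
    rw [div_lt_iff₀ hs0] at hp'
    rw [div_neg, lt_neg, div_lt_iff₀ hs0] at hn'
    rw [abs_le]
    constructor
    · by_contra! hcon
      nlinarith
    · by_contra! hcon
      nlinarith
  refine ⟨s * (ε / 4), by positivity, fun φ ψ hφ hψ hφa hψa =>
    norm_le_of_re_le hε.le fun b hb => ?_⟩
  have h₁ := abs_le.1 (key φ hφ hφa b hb)
  have h₂ := abs_le.1 (key ψ hψ hψa b hb)
  rw [sub_apply, Complex.sub_re]
  linarith [h₁.1, h₂.2]

theorem AssociatedIsBanachBundle.isQuotientVectorBundle_codual (hrefl : IsReflexive A)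
    (hsmooth : IsFrechetSmooth A) (h : AssociatedIsBanachBundle κ) :
    IsQuotientVectorBundle (codual κ) := by
  rw [isQuotientVectorBundle_iff]
  intro U hU
  rw [isOpen_iff_mem_nhds]
  rintro x ⟨φ₀, hφ₀, hφ₀U⟩
  rcases eq_or_ne φ₀ 0 with rfl | hne
  · exact Eventually.of_forall fun y => ⟨0, zero_mem _, hφ₀U⟩
  have hpos : 0 < ‖φ₀‖ := norm_pos_iff.2 hne
  -- Normalise `φ₀`.
  obtain ⟨c, φ, hφ, hφ₁, rfl⟩ :
      ∃ c : ℂ, ∃ φ ∈ annihilator (κ x), ‖φ‖ = 1 ∧ φ₀ = c • φ := by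
    refine ⟨‖φ₀‖, ((‖φ₀‖ : ℂ)⁻¹) • φ₀, Submodule.smul_mem _ _ hφ₀, ?_, ?_⟩
    · simp [norm_smul, hpos.ne']
    · rw [smul_smul, mul_inv_cancel₀ (by exact_mod_cast hpos.ne'), one_smul]
  obtain ⟨a, ha, hφa⟩ := hrefl.exists_apply_eq_norm φ
  rw [hφ₁, Complex.ofReal_one] at hφa
  have ha₁ : ‖a‖ = 1 := by
    refine le_antisymm ha ?_
    have := φ.le_of_opNorm_le hφ₁.le a
    rwa [hφa, norm_one, one_mul] at this
  have hO : IsOpen ((fun ψ : StrongDual ℂ A => c • ψ) ⁻¹' U) := hU.preimage (by fun_prop)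
  obtain ⟨ε, hε, hball⟩ := Metric.isOpen_iff.1 hO φ hφ₀U
  obtain ⟨η, hη, hclose⟩ := hsmooth.exists_norm_sub_le ha₁ (half_pos hε)
  -- As `φ` kills `κ x` and `φ a = 1`, the point `a` has distance at least `1` from `κ x`.
  have hdist : 1 - η < ‖(Submodule.Quotient.mk a : A ⧸ κ x)‖ := by
    have := norm_apply_le_of_mem_annihilator hφ hφ₁.le a
    rw [hφa, norm_one] at this
    linarith
  filter_upwards [(h.continuous_norm_mk a).continuousAt.eventually_const_lt hdist] with y hy
  obtain ⟨ψ, hψ, hψ₁, hψa⟩ := exists_mem_annihilator_apply_eq (κ y) a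
  refine ⟨c • ψ, Submodule.smul_mem _ _ hψ, hball (mem_ball_iff_norm.2 ?_)⟩
  refine (hclose φ ψ hφ₁.le hψ₁ ?_ ?_).trans_lt (half_lt_self hε)
  · rw [hφa, Complex.one_re]; linarith
  · rw [hψa, Complex.ofReal_re]; exact hy.le

end Smooth

end QVB

theorem corollary7p4 {X A : Type*} [TopologicalSpace X] [FirstCountableTopology X] [T2Space X]
    [NormedAddCommGroup A] [NormedSpace ℂ A] [CompleteSpace A]
    (κ : X → Submodule ℂ A) (hclosed : ∀ x, IsClosed (κ x : Set A))
    (hκ : QVB.IsQuotientVectorBundle κ) :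
    (QVB.IsQuotientVectorBundle (QVB.codual κ) →
      QVB.AssociatedIsBanachBundle κ ∧ QVB.AssociatedIsBanachBundle (QVB.codual κ)) ∧
    (QVB.IsReflexive A → QVB.IsFrechetSmooth A →
      (QVB.AssociatedIsBanachBundle κ ↔ QVB.AssociatedIsBanachBundle (QVB.codual κ))) := by
  have key : QVB.IsQuotientVectorBundle (QVB.codual κ) →
      QVB.AssociatedIsBanachBundle κ ∧ QVB.AssociatedIsBanachBundle (QVB.codual κ) := fun h =>
    ⟨hκ.associatedIsBanachBundle hclosed h.lowerSemicontinuous_norm_of_codual,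
      h.associatedIsBanachBundle (fun x => QVB.isClosed_annihilator (κ x))
        hκ.lowerSemicontinuous_norm_codual⟩
  refine ⟨key, fun hrefl hsmooth => ⟨fun h => ?_, fun h => ?_⟩⟩
  · exact (key (h.isQuotientVectorBundle_codual hrefl hsmooth)).2
  · exact (key h.isQuotientVectorBundle).1
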